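/- Let $r\ge 1$ and $n\ge 0$ be integers. For $m\ge 0$ consider polynomials over $\mathbb{Q}$ in $r$ sets of $m$ variables $\mathbf{x}=x_1,\ldots,x_m$, $\mathbf{y}=y_1,\ldots,y_m$, etc., on which $\mathbb{S}_m$ acts diagonally: $\sigma$ sends $u_i$ to $u_{\sigma(i)}$ for each set of variables $\mathbf{u}$. For a polynomial $p$, let $\mathcal{L}_{\partial,E}[p]$ be the smallest $\mathbb{Q}$-vector space that contains $p$ and is closed under all partial derivatives and under the operators $E_{\mathbf{u}\mathbf{v}}^{(k)}=\sum_{i=1}^m u_i\,\partial_{v_i}^k$, for any two distinct sets of variables $\mathbf{u},\mathbf{v}$ among the $r$ sets and any $k\ge 1$. Let $\Delta_m(\mathbf{x})$ be the Vandermonde determinant in $x_1,\ldots,x_m$, let $e_n(\mathbf{x})=x_1\cdots x_n$, and put $$\mathrm{Diag}[n;n]:=\mathcal{L}_{\partial,E}[e_n(\mathbf{x})\,\Delta_n(\mathbf{x})],\qquad \mathrm{Diag}[n+1]:=\mathcal{L}_{\partial,E}[\Delta_{n+1}(x_1,\ldots,x_{n+1})].$$ These are respectively an $\mathbb{S}_n$-module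 and an $\mathbb{S}_{n+1}$-module. For a homogeneous component of vector degree $\mathbf{d}\in\mathbb{N}^r$ (degree in $\mathbf{x}$, degree in $\mathbf{y}$, etc.) of such a module $\mathscr{V}$ over $\mathbb{S}_m$, let $\mathscr{V}_{\mathbf{d}}(\mathbf{w})=\frac{1}{m!}\sum_{\sigma\in\mathbb{S}_m}\chi_{\mathscr{V}_{\mathbf{d}}}(\sigma)\,p_{\lambda(\sigma)}(\mathbf{w})$ be its Frobenius characteristic, where $\chi_{\mathscr{V}_{\mathbf{d}}}$ is the character, $\lambda(\sigma)$ is the cycle type of $\sigma$, and $p_\lambda$ is the power sum symmetric function; and let $\mathscr{V}(\mathbf{w};\mathbf{q})=\sum_{\mathbf{d}} q_1^{d_1}\cdots q_r^{d_r}\,\mathscr{V}_{\mathbf{d}}(\mathbf{w})$. Let $\partial p_1$ be the operator that expands a symmetric function as a polynomial in the power sums $p_1,p_2,\ldots$ and differentiates it with respect to $p_1$, extended coefficientwise to series in $\mathbf{q}$. Then $\mathrm{Diag}[n;n]$ and $\mathrm{Diag}[n+1]$ are each the direct sum of their homogeneous components for the vector degree, and there is an isomorphism of $\mathbb{S}_n$-modules,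 preserving the vector degree, from $\mathrm{Diag}[n;n]$ to the restriction of $\mathrm{Diag}[n+1]$ to $\mathbb{S}_n$ (the permutations of the first $n$ indices). Moreover $$\mathrm{Diag}[n;n](\mathbf{w};\mathbf{q})=\partial p_1\,\mathrm{Diag}[n+1](\mathbf{w};\mathbf{q}).$$ -/

import Mathlib

noncomputable section

namespace DiagonalModules

open MvPolynomial

/-- The power sum `p_k = ∑ i, w_i ^ k` (for `k ≥ 1`) in the variables `w_0, w_1, …`. -/
def powerSum (k : ℕ) : MvPowerSeries ℕ ℚ := by
  classical exact fun m => if ∃ i, m = Finsupp.single i k then 1 else 0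

theorem pderiv_powerSum (i k : ℕ) :
    MvPowerSeries.pderiv ℚ i (powerSum (k + 1)) =
      ((k : ℚ) + 1) • (MvPowerSeries.X i : MvPowerSeries ℕ ℚ) ^ k := by
  classical
  ext m
  rw [MvPowerSeries.coeff_pderiv, map_smul, MvPowerSeries.coeff_X_pow]
  have h : MvPowerSeries.coeff (m + Finsupp.single i 1) (powerSum (k + 1)) =
      if ∃ j, m + Finsupp.single i 1 = Finsupp.single j (k + 1) then 1 else 0 := rfl
  rw [h]
  have h2 : (∃ j, m + Finsupp.single i 1 = Finsupp.single j (k + 1)) ↔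
      m = Finsupp.single i k := by
    constructor
    · rintro ⟨j, hj⟩
      have hij : j = i := by
        by_contra hne
        have := DFunLike.congr_fun hj i
        simp [hne] at this
      subst hij
      rw [Finsupp.single_add] at hj
      exact add_right_cancel hj
    · rintro rfl
      exact ⟨i, by rw [← Finsupp.single_add]⟩
  simp only [h2]
  split_ifs with h3
  · subst h3
    simp
  · simp

theorem derivation_aeval {N : ℕ} (x : Fin N → MvPowerSeries ℕ ℚ) (i : ℕ)
    (P : MvPolynomial (Fin N) ℚ) :
    MvPowerSeries.pderiv ℚ i (aeval x P) =
      ∑ k, aeval x (pderiv k P) * MvPowerSeries.pderiv ℚ i (x k) := by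
  induction P using MvPolynomial.induction_on with
  | C a => simp
  | add p q hp hq => simp [hp, hq, add_mul, Finset.sum_add_distrib]
  | mul_X p j hp =>
    simp only [map_mul, aeval_X, Derivation.leibniz, hp, smul_eq_mul, pderiv_X, map_add, add_mul,
      Finset.sum_add_distrib, Finset.mul_sum]
    congr 1
    · rw [Finset.sum_eq_single j]
      · simp
      · intro b _ hb
        simp [hb.symm]
      · simp
    · refine Finset.sum_congr rfl fun k _ => by ring

theorem eq_C_of_pderiv_eq_zero {σ : Type*} (P : MvPolynomial σ ℚ) (h : ∀ k, pderiv k P = 0) :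
    P = C (coeff 0 P) := by
  classical
  ext m
  rw [coeff_C]
  split_ifs with hm
  · rw [hm]
  · obtain ⟨i, hi⟩ : ∃ i, m i ≠ 0 := by
      by_contra hc
      push Not at hc
      exact hm (by ext i; simp [hc i])
    have h1 := congrArg (coeff (m - Finsupp.single i 1)) (h i)
    rw [coeff_pderiv, tsub_add_cancel_of_le
      (Finsupp.single_le_iff.mpr (Nat.one_le_iff_ne_zero.mpr hi))] at h1
    rw [coeff_zero] at h1
    rcases mul_eq_zero.mp h1 with h2 | h2
    · exact h2
    · exact absurd h2 (by positivity)

theorem totalDegree_pderiv_le_of_succ {σ : Type*} (P : MvPolynomial σ ℚ) (k : σ) (d : ℕ)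
    (h : P.totalDegree ≤ d + 1) : (pderiv k P).totalDegree ≤ d := by
  classical
  refine Finset.sup_le fun m hm => ?_
  rw [mem_support_iff, coeff_pderiv] at hm
  have h1 := le_totalDegree (mem_support_iff.mpr (left_ne_zero_of_mul hm))
  rw [Finsupp.sum_add_index' (fun _ => rfl) (fun _ _ _ => rfl)] at h1
  simp at h1
  omega

theorem algebraicIndependent_powerSum_fin (N : ℕ) :
    AlgebraicIndependent ℚ fun k : Fin N => powerSum (k + 1) := by
  rw [algebraicIndependent_iff]
  have hdom : IsDomain (MvPowerSeries ℕ ℚ) := NoZeroDivisors.to_isDomain _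
  suffices h : ∀ d (P : MvPolynomial (Fin N) ℚ), P.totalDegree ≤ d →
      aeval (fun k : Fin N => powerSum (k + 1)) P = 0 → P = 0 from fun P => h _ P le_rfl
  intro d
  induction d with
  | zero =>
    intro P hd hP
    rw [totalDegree_eq_zero_iff_eq_C.mp (Nat.le_zero.mp hd)] at hP ⊢
    simpa using hP
  | succ d ih =>
    intro P hd hP
    have key : ∀ k, pderiv k P = 0 := by
      have hv : (fun k : Fin N => ((k : ℚ) + 1) •
          aeval (fun k : Fin N => powerSum (k + 1)) (pderiv k P)) = 0 := by
        refine Matrix.eq_zero_of_forall_index_sum_pow_mul_eq_zero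
          (f := fun i : Fin N => (MvPowerSeries.X (i : ℕ) : MvPowerSeries ℕ ℚ)) ?_ ?_
        · intro a b hab
          exact Fin.ext (MvPowerSeries.X_inj.mp hab)
        · intro i
          have := derivation_aeval (fun k : Fin N => powerSum (k + 1)) (i : ℕ) P
          rw [hP, map_zero] at this
          rw [this]
          refine Finset.sum_congr rfl fun k _ => ?_
          rw [pderiv_powerSum]
          simp [mul_comm]
      intro k
      apply ih _ (totalDegree_pderiv_le_of_succ P k d hd)
      have h1 := congrFun hv k
      exact (smul_eq_zero.mp h1).resolve_left (by positivity)
    have hC := eq_C_of_pderiv_eq_zero P key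
    rw [hC] at hP ⊢
    simpa using hP

theorem algebraicIndependent_powerSum : AlgebraicIndependent ℚ fun k : ℕ => powerSum (k + 1) := by
  rw [algebraicIndependent_iff]
  intro P hP
  obtain ⟨N, hN⟩ : ∃ N, ∀ i ∈ P.vars, i < N :=
    ⟨P.vars.sup id + 1, fun i hi => Nat.lt_succ_of_le (Finset.le_sup (f := id) hi)⟩
  obtain ⟨Q, rfl⟩ := exists_rename_eq_of_vars_subset_range P (Fin.val : Fin N → ℕ)
    Fin.val_injective (fun i hi => ⟨⟨i, hN i hi⟩, rfl⟩)
  rw [aeval_rename] at hP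
  rw [algebraicIndependent_iff.mp (algebraicIndependent_powerSum_fin N) Q hP, map_zero]

/-- The ring `Λ` of symmetric functions over `ℚ` in `w_0, w_1, …`: over a field of characteristic
zero it is generated by the power sums `p_1, p_2, …`. -/
def SymmFun : Subalgebra ℚ (MvPowerSeries ℕ ℚ) :=
  Algebra.adjoin ℚ (Set.range fun k : ℕ => powerSum (k + 1))

theorem powerSum_zero : powerSum 0 = 1 := by
  classical
  ext m
  rw [MvPowerSeries.coeff_one]
  have h : MvPowerSeries.coeff m (powerSum 0) =
      if ∃ j, m = Finsupp.single j 0 then 1 else 0 := rfl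
  rw [h]
  simp

theorem powerSum_mem (k : ℕ) : powerSum k ∈ SymmFun := by
  cases k with
  | zero => rw [powerSum_zero]; exact one_mem _
  | succ k => exact Algebra.subset_adjoin ⟨k, rfl⟩

/-- The power sum `p_k` as an element of `Λ` (used for `k ≥ 1`). -/
def psumSymm (k : ℕ) : SymmFun := ⟨powerSum k, powerSum_mem k⟩

/-- `Λ = ℚ[p_1, p_2, …]`; the variable `X k` of the polynomial ring corresponds to `p_{k+1}`. -/
def powerSumEquiv : MvPolynomial ℕ ℚ ≃ₐ[ℚ] SymmFun :=
  algebraicIndependent_powerSum.aevalEquiv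

/-- The operator `∂p_1` on `Λ`: expand a symmetric function as a polynomial in the power sums
`p_1, p_2, …`, and differentiate formally with respect to `p_1`. -/
def dp1 : SymmFun →ₗ[ℚ] SymmFun :=
  powerSumEquiv.toLinearMap ∘ₗ (pderiv 0 : Derivation ℚ (MvPolynomial ℕ ℚ) _).toLinearMap ∘ₗ
    powerSumEquiv.symm.toLinearMap

/-- The Frobenius characteristic of a finite-dimensional representation of `S_n`,
`(1 / n!) ∑_σ χ(σ) p_{λ(σ)}`, where `λ(σ)` is the cycle type of `σ` (fixed points included). -/
def frobChar {n : ℕ} {V : Type*} [AddCommGroup V] [Module ℚ V]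
    (ρ : Representation ℚ (Equiv.Perm (Fin n)) V) : SymmFun :=
  (1 / (n.factorial : ℚ)) •
    ∑ σ : Equiv.Perm (Fin n), ρ.character σ • (σ.partition.parts.map psumSymm).prod

/-- Polynomials over `ℚ` in `r` sets of `n` variables; `X (u, i)` is the `i`-th variable of the
set number `u`. -/
abbrev Poly (r n : ℕ) : Type := MvPolynomial (Fin r × Fin n) ℚ

/-- The diagonal permutation of variables: `σ` sends `u_i` to `u_{σ(i)}`, for every set `u`. -/
def permVars (r : ℕ) {n : ℕ} (σ : Equiv.Perm (Fin n)) : Poly r n →ₐ[ℚ] Poly r n :=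
  rename (Prod.map id σ)

/-- The diagonal action of `S_n` on polynomials in `r` sets of `n` variables. -/
def diagAction (r n : ℕ) : Representation ℚ (Equiv.Perm (Fin n)) (Poly r n) where
  toFun σ := (permVars r σ).toLinearMap
  map_one' := by
    refine LinearMap.ext fun p => ?_
    have h : (Prod.map id ((1 : Equiv.Perm (Fin n)) : Fin n → Fin n) : Fin r × Fin n → _) = id := by
      ext x <;> rfl
    rw [AlgHom.toLinearMap_apply, permVars, h, rename_id_apply, Module.End.one_apply]
  map_mul' σ τ := by
    refine LinearMap.ext fun p => ?_
    rw [Module.End.mul_apply, AlgHom.toLinearMap_apply, AlgHom.toLinearMap_apply,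
      AlgHom.toLinearMap_apply, permVars, permVars, permVars, rename_rename, Prod.map_comp_map]
    rfl

theorem diagAction_apply {r n : ℕ} (σ : Equiv.Perm (Fin n)) (p : Poly r n) :
    diagAction r n σ p = permVars r σ p := rfl

/-- The operator `E_{uv}^{(k)} = ∑ i, u_i (∂ / ∂ v_i) ^ k`. -/
def opE {r n : ℕ} (u v : Fin r) (k : ℕ) : Module.End ℚ (Poly r n) :=
  ∑ i : Fin n, LinearMap.mulLeft ℚ (X (u, i)) ∘ₗ ((pderiv (v, i)).toLinearMap ^ k)

/-- `W` is closed under all partial derivatives and under the operators `E_{uv}^{(k)}`, `k ≥ 1`, for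
any two of the `r` sets of variables. -/
structure IsClosedUnderOps {r n : ℕ} (W : Submodule ℚ (Poly r n)) : Prop where
  pderiv_mem : ∀ (u : Fin r) (i : Fin n), ∀ f ∈ W, pderiv (u, i) f ∈ W
  opE_mem : ∀ u v : Fin r, u ≠ v → ∀ k : ℕ, 1 ≤ k → ∀ f ∈ W, opE u v k f ∈ W

/-- `L_{∂,E}[p]`: the smallest vector space that contains `p` and is closed under partial derivatives
and under the operators `E_{uv}^{(k)}`. -/
def opSpan {r n : ℕ} (p : Poly r n) : Submodule ℚ (Poly r n) :=
  sInf {W | p ∈ W ∧ IsClosedUnderOps W}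

/-- A polynomial in `n` variables, seen as a polynomial in the first set of variables `x`. -/
def inX {r n : ℕ} [NeZero r] : MvPolynomial (Fin n) ℚ →ₐ[ℚ] Poly r n :=
  rename fun i => (0, i)

/-- The Vandermonde determinant in the first set of variables `x`. -/
def vandermondeX (r n : ℕ) [NeZero r] : Poly r n :=
  (Matrix.vandermonde fun i : Fin n => (X (0, i) : Poly r n)).det

theorem diagAction_pderiv {r n : ℕ} (σ : Equiv.Perm (Fin n)) (u : Fin r) (i : Fin n)
    (f : Poly r n) :
    pderiv (u, σ i) (diagAction r n σ f) = diagAction r n σ (pderiv (u, i) f) := by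
  rw [diagAction_apply, diagAction_apply, permVars]
  exact pderiv_rename (Function.injective_id.prodMap σ.injective) (u, i) f

theorem diagAction_pderiv_pow {r n : ℕ} (σ : Equiv.Perm (Fin n)) (u : Fin r) (i : Fin n) (k : ℕ)
    (f : Poly r n) :
    ((pderiv (u, σ i)).toLinearMap ^ k : Module.End ℚ (Poly r n)) (diagAction r n σ f) =
      diagAction r n σ (((pderiv (u, i)).toLinearMap ^ k : Module.End ℚ (Poly r n)) f) := by
  induction k generalizing f with
  | zero => rfl
  | succ k ih =>
    rw [pow_succ, pow_succ, Module.End.mul_apply, Module.End.mul_apply, ← ih]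
    exact congrArg _ (diagAction_pderiv σ u i f)

theorem diagAction_opE {r n : ℕ} (σ : Equiv.Perm (Fin n)) (u v : Fin r) (k : ℕ) (f : Poly r n) :
    opE u v k (diagAction r n σ f) = diagAction r n σ (opE u v k f) := by
  simp only [opE, LinearMap.sum_apply, map_sum, LinearMap.comp_apply, LinearMap.mulLeft_apply]
  rw [← Equiv.sum_comp σ]
  refine Finset.sum_congr rfl fun i _ => ?_
  rw [diagAction_pderiv_pow, diagAction_apply, diagAction_apply, map_mul]
  congr 1
  rw [permVars, rename_X]
  rfl

theorem diagAction_vandermondeX {r n : ℕ} [NeZero r] (σ : Equiv.Perm (Fin n)) :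
    diagAction r n σ (vandermondeX r n) = (Equiv.Perm.sign σ : ℤ) • vandermondeX r n := by
  have h : diagAction r n σ (vandermondeX r n) =
      ((Matrix.vandermonde fun i : Fin n => (X (0, i) : Poly r n)).submatrix σ id).det := by
    rw [diagAction_apply, vandermondeX, AlgHom.map_det]
    congr 1
    ext1 i j
    simp [Matrix.vandermonde, permVars]
  rw [h, Matrix.det_permute, vandermondeX, zsmul_eq_mul]

theorem diagAction_inX {r n : ℕ} [NeZero r] (σ : Equiv.Perm (Fin n))
    (f : symmetricSubalgebra (Fin n) ℚ) :
    diagAction r n σ (inX (f : MvPolynomial (Fin n) ℚ)) = inX (f : MvPolynomial (Fin n) ℚ) := by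
  have h : rename σ (f : MvPolynomial (Fin n) ℚ) = f := (mem_symmetricSubalgebra _).mp f.2 σ
  conv_rhs => rw [← h]
  rw [diagAction_apply, permVars, inX, rename_rename, rename_rename]
  rfl

theorem diagAction_opSpan {r n : ℕ} [NeZero r] (f : symmetricSubalgebra (Fin n) ℚ)
    (σ : Equiv.Perm (Fin n)) ⦃p : Poly r n⦄
    (hp : p ∈ opSpan (inX (f : MvPolynomial (Fin n) ℚ) * vandermondeX r n)) :
    diagAction r n σ p ∈ opSpan (inX (f : MvPolynomial (Fin n) ℚ) * vandermondeX r n) := by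
  rw [opSpan, Submodule.mem_sInf]
  rintro W ⟨hW, hc⟩
  have h2 : p ∈ W.comap (diagAction r n σ) := by
    refine Submodule.mem_sInf.mp hp _ ⟨?_, ?_, ?_⟩
    · have h3 : diagAction r n σ (inX (f : MvPolynomial (Fin n) ℚ) * vandermondeX r n) =
          (Equiv.Perm.sign σ : ℤ) • (inX (f : MvPolynomial (Fin n) ℚ) * vandermondeX r n) := by
        rw [← mul_smul_comm, ← diagAction_vandermondeX, diagAction_apply, map_mul,
          ← diagAction_apply, ← diagAction_apply, diagAction_inX]
      rw [Submodule.mem_comap, h3]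
      exact zsmul_mem hW _
    · intro u i g hg
      rw [Submodule.mem_comap, ← diagAction_pderiv]
      exact hc.pderiv_mem _ _ _ hg
    · intro u v huv k hk g hg
      rw [Submodule.mem_comap, ← diagAction_opE]
      exact hc.opE_mem u v huv k hk _ hg
  exact h2

/-- The `S_n`-module `Diag[n; f] = L_{∂,E}[f(x) Δ_n(x)]`, for a symmetric polynomial `f` and `r` sets
of variables. -/
def Diag (r n : ℕ) [NeZero r] (f : symmetricSubalgebra (Fin n) ℚ) :
    Subrepresentation (diagAction r n) where
  toSubmodule := opSpan (inX (f : MvPolynomial (Fin n) ℚ) * vandermondeX r n)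
  apply_mem_toSubmodule σ _ hp := diagAction_opSpan f σ hp

/-- The `S_n`-module of polynomials that are homogeneous of vector degree `d`, that is of degree
`d u` in the set of variables number `u`, for every `u`. -/
def homogeneousPart (r n : ℕ) (d : Fin r →₀ ℕ) : Subrepresentation (diagAction r n) where
  toSubmodule := weightedHomogeneousSubmodule ℚ
    (fun p : Fin r × Fin n => (Finsupp.single p.1 1 : Fin r →₀ ℕ)) d
  apply_mem_toSubmodule σ p hp := by
    classical
    rw [mem_weightedHomogeneousSubmodule] at hp ⊢
    intro m hm
    rw [diagAction_apply, permVars] at hm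
    obtain ⟨m', rfl, hm'⟩ := coeff_rename_ne_zero _ p m hm
    rw [← hp hm', Finsupp.weight_apply, Finsupp.weight_apply]
    exact Finsupp.sum_mapDomain_index (fun _ => zero_smul _ _) (fun _ _ _ => add_smul _ _ _)

/-- `M` is graded by the vector degree: it is the direct sum of its homogeneous components (which
are always independent of each other), that is, it is spanned by them. -/
def IsGradedByDegree {r n : ℕ} (M : Subrepresentation (diagAction r n)) : Prop :=
  ⨆ d, (M ⊓ homogeneousPart r n d).toSubmodule = M.toSubmodule

/-- The graded Frobenius characteristic `∑_d q^d M_d(w)`, a series in `q = q_1, …, q_r` with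
coefficients in `Λ`. -/
def gradedFrob {r n : ℕ} (M : Subrepresentation (diagAction r n)) :
    MvPowerSeries (Fin r) SymmFun :=
  fun d => frobChar (M ⊓ homogeneousPart r n d).toRepresentation

/-- The operator `∂p_1`, extended coefficientwise to series in `q`. -/
def dp1Series {r : ℕ} (F : MvPowerSeries (Fin r) SymmFun) : MvPowerSeries (Fin r) SymmFun :=
  fun d => dp1 (MvPowerSeries.coeff d F)

/-- The elementary symmetric polynomial `e_k` in `n` variables. -/
def elem (n k : ℕ) : symmetricSubalgebra (Fin n) ℚ :=
  ⟨esymm (Fin n) ℚ k, (mem_symmetricSubalgebra _).mpr (esymm_isSymmetric (Fin n) ℚ k)⟩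

/-- The inclusion of `S_n` in `S_{n+1}`, as the permutations of the first `n` indices. -/
def permSucc (n : ℕ) : Equiv.Perm (Fin n) →* Equiv.Perm (Fin (n + 1)) :=
  Equiv.Perm.viaEmbeddingHom Fin.castSuccEmb

end DiagonalModules

end

noncomputable section

namespace DiagonalModules

open MvPolynomial

/-!
The Vandermonde determinant `Δ_{n+1}(x)` is harmonic: it is killed by `∑ i, P(∂_{x_i}, ∂_{y_i}, …)`
for every `P` without constant term. The space of all harmonic polynomials is closed under partial
derivatives and also under `E_{uv}^{(k)}`, because the commutator of `∑ i, P(∂_i)` with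
`E_{uv}^{(k)}` is the operator `∑ i, Q(∂_i)` for `Q = (∂P / ∂u) v ^ k`. So all of `Diag[n+1]` is
harmonic, and the polynomials `P` of degree one say that it is translation invariant: an element is
determined by its restriction to `u_{n+1} = 0`, and it is recovered by `u_i ↦ u_i - u_{n+1}`.

On `Diag[n+1]` restriction commutes with the operators (a derivative in `u_{n+1}` being minus the
sum of the other derivatives), and it sends `Δ_{n+1}` to `± e_n Δ_n`. So it maps `Diag[n+1]` onto
`Diag[n;n]`, compatibly with the action of `S_n` and the vector degree.

Finally `∂p_1` of a Frobenius characteristic is the characteristic of the restriction to `S_n`: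
`∂p_1` sends `p_λ` to `m p_{λ ∖ 1}`, where `m` is the number of fixed points when `λ` is the cycle
type of a permutation, and averaging a class function over the pairs of a permutation and one of its
fixed points amounts to averaging it over the stabilizer of a point.
-/

section CommutingFamilies

variable {R A κ σ : Type*}

/-- Evaluation of a polynomial at a pairwise commuting family `D` of elements of an algebra that
need not be commutative, through the commutative subalgebra generated by `D`. -/
def aevalOfCommute [CommSemiring R] [Semiring A] [Algebra R A] (D : κ → A)
    (hD : ∀ a b, Commute (D a) (D b)) : MvPolynomial κ R →ₐ[R] A :=
  haveI : IsMulCommutative (Algebra.adjoin R (Set.range D)) :=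
    Algebra.isMulCommutative_adjoin R (by rintro _ ⟨a, rfl⟩ _ ⟨b, rfl⟩; exact hD a b)
  open scoped IsMulCommutative in
  (Algebra.adjoin R (Set.range D)).val.comp
    (aeval fun a => ⟨D a, Algebra.subset_adjoin (Set.mem_range_self a)⟩)

@[simp]
theorem aevalOfCommute_X [CommSemiring R] [Semiring A] [Algebra R A] (D : κ → A)
    (hD : ∀ a b, Commute (D a) (D b)) (a : κ) :
    aevalOfCommute (R := R) D hD (X a) = D a := by
  simp [aevalOfCommute]

theorem commute_aevalOfCommute [CommSemiring R] [Semiring A] [Algebra R A] {D : κ → A}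
    (hD : ∀ a b, Commute (D a) (D b)) {x : A} (hx : ∀ a, Commute (D a) x)
    (P : MvPolynomial κ R) : Commute (aevalOfCommute D hD P) x := by
  induction P using MvPolynomial.induction_on with
  | C c => simpa only [← algebraMap_eq, AlgHom.commutes] using Algebra.commute_algebraMap_left c x
  | add P Q hP hQ => simpa using hP.add_left hQ
  | mul_X P a hP => simpa using hP.mul_left (hx a)

theorem commute_pderiv [CommRing R] (a b : σ) :
    Commute ((pderiv a).toLinearMap : Module.End R (MvPolynomial σ R))
      (pderiv b).toLinearMap := by
  classical
  have h : ⁅pderiv (R := R) a, pderiv b⁆ = 0 := derivation_ext fun c => by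
    rw [Derivation.commutator_apply]
    simp [pderiv_X, Pi.single_apply, apply_ite]
  exact LinearMap.ext fun f => sub_eq_zero.mp (DFunLike.congr_fun h f)

end CommutingFamilies

section ConstantCoefficientOperators

variable {r n : ℕ}

/-- The differential operator `P(∂_{x_i}, ∂_{y_i}, …)` with constant coefficients, for a polynomial
`P` with one variable for each of the `r` sets. -/
def diffOp (i : Fin n) : MvPolynomial (Fin r) ℚ →ₐ[ℚ] Module.End ℚ (Poly r n) :=
  aevalOfCommute (fun u => (pderiv (u, i)).toLinearMap) fun u v => commute_pderiv (u, i) (v, i)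

theorem diffOp_X (i : Fin n) (u : Fin r) : diffOp i (X u) = (pderiv (u, i)).toLinearMap :=
  aevalOfCommute_X _ _ u

theorem diffOp_X_pow_apply (i : Fin n) (u : Fin r) (k : ℕ) (f : Poly r n) :
    diffOp i (X u ^ k) f = (pderiv (u, i))^[k] f := by
  rw [map_pow, diffOp_X, Module.End.pow_apply]
  rfl

theorem diffOp_pderiv (i j : Fin n) (u : Fin r) (P : MvPolynomial (Fin r) ℚ) (f : Poly r n) :
    diffOp i P (pderiv (u, j) f) = pderiv (u, j) (diffOp i P f) := by
  have h : Commute (diffOp i P) (pderiv (u, j)).toLinearMap :=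
    commute_aevalOfCommute _ (fun v => commute_pderiv (v, i) (u, j)) P
  exact LinearMap.congr_fun h.eq f

theorem opE_apply (u v : Fin r) (k : ℕ) (f : Poly r n) :
    opE u v k f = ∑ i, X (u, i) * (pderiv (v, i))^[k] f := by
  simp only [opE, LinearMap.sum_apply, LinearMap.comp_apply, LinearMap.mulLeft_apply,
    Module.End.pow_apply, Derivation.coeFn_coe]

theorem pderiv_opE (u v w : Fin r) (i : Fin n) (k : ℕ) (f : Poly r n) :
    pderiv (w, i) (opE u v k f) =
      opE u v k (pderiv (w, i) f) + diffOp i (pderiv u (X w) * X v ^ k) f := by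
  classical
  have hcomm (j : Fin n) :
      pderiv (w, i) ((pderiv (v, j))^[k] f) = (pderiv (v, j))^[k] (pderiv (w, i) f) := by
    simp only [← diffOp_X_pow_apply, diffOp_pderiv]
  simp only [opE_apply, map_sum, pderiv_mul, hcomm, Finset.sum_add_distrib]
  rw [add_comm]
  congr 1
  rw [Finset.sum_eq_single i (fun j _ hj => by rw [pderiv_X_of_ne (by simp [hj]), zero_mul])
    (by simp), ← diffOp_X_pow_apply]
  rcases eq_or_ne w u with rfl | huw
  · simp
  · rw [pderiv_X_of_ne huw, pderiv_X_of_ne (by simp [huw.symm])]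
    simp

theorem diffOp_opE (u v : Fin r) (k : ℕ) (i : Fin n) (P : MvPolynomial (Fin r) ℚ)
    (f : Poly r n) :
    diffOp i P (opE u v k f) = opE u v k (diffOp i P f) + diffOp i (pderiv u P * X v ^ k) f := by
  induction P using MvPolynomial.induction_on generalizing f with
  | C c => simp [← algebraMap_eq]
  | add P Q hP hQ =>
    simp only [map_add, add_mul, LinearMap.add_apply, hP, hQ]
    abel
  | mul_X P w hP =>
    have hX (g : Poly r n) : diffOp i (P * X w) g = diffOp i P (pderiv (w, i) g) := by
      rw [map_mul, diffOp_X]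
      rfl
    have hleibniz : pderiv u (P * X w) * X v ^ k =
        pderiv u P * X v ^ k * X w + P * (pderiv u (X w) * X v ^ k) := by
      rw [pderiv_mul]
      ring
    have hPX : diffOp i (pderiv u P * X v ^ k) (pderiv (w, i) f) =
        diffOp i (pderiv u P * X v ^ k * X w) f := by
      rw [map_mul _ (_ * _) (X w), diffOp_X]
      rfl
    rw [hX, hX, pderiv_opE, map_add, hP, hleibniz, map_add, LinearMap.add_apply, hPX,
      map_mul _ P, Module.End.mul_apply, add_assoc]

/-- The polarized harmonic polynomials: those killed by `∑ i, P(∂_{x_i}, ∂_{y_i}, …)` for every `P`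
without constant term. -/
def harmonics (r n : ℕ) : Submodule ℚ (Poly r n) :=
  ⨅ (P : MvPolynomial (Fin r) ℚ) (_ : constantCoeff P = 0), LinearMap.ker (∑ i, diffOp i P)

theorem mem_harmonics {f : Poly r n} :
    f ∈ harmonics r n ↔
      ∀ P : MvPolynomial (Fin r) ℚ, constantCoeff P = 0 → ∑ i, diffOp i P f = 0 := by
  simp [harmonics, Submodule.mem_iInf]

theorem isClosedUnderOps_harmonics : IsClosedUnderOps (harmonics r n) where
  pderiv_mem u j f hf := mem_harmonics.mpr fun P hP => by
    simp only [diffOp_pderiv, ← map_sum, mem_harmonics.mp hf P hP, map_zero]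
  opE_mem u v _ k hk f hf := mem_harmonics.mpr fun P hP => by
    have hPk : constantCoeff (pderiv u P * X v ^ k) = 0 := by
      simp [Nat.one_le_iff_ne_zero.mp hk]
    simp only [diffOp_opE, Finset.sum_add_distrib, ← map_sum, mem_harmonics.mp hf P hP,
      mem_harmonics.mp hf _ hPk, map_zero, add_zero]

end ConstantCoefficientOperators

section OpSpan

variable {r n : ℕ}

theorem mem_opSpan_self (p : Poly r n) : p ∈ opSpan p :=
  Submodule.mem_sInf.mpr fun _ hW => hW.1

theorem opSpan_le {p : Poly r n} {W : Submodule ℚ (Poly r n)} (hp : p ∈ W)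
    (hW : IsClosedUnderOps W) : opSpan p ≤ W :=
  sInf_le ⟨hp, hW⟩

theorem isClosedUnderOps_opSpan (p : Poly r n) : IsClosedUnderOps (opSpan p) where
  pderiv_mem u i f hf := Submodule.mem_sInf.mpr fun W hW =>
    hW.2.pderiv_mem u i f (Submodule.mem_sInf.mp hf W hW)
  opE_mem u v huv k hk f hf := Submodule.mem_sInf.mpr fun W hW =>
    hW.2.opE_mem u v huv k hk f (Submodule.mem_sInf.mp hf W hW)

end OpSpan

section Determinants

variable {R A ι : Type*} [CommSemiring R] [CommRing A] [Algebra R A] [DecidableEq ι]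

theorem derivation_prod (D : Derivation R A A) (s : Finset ι) (f : ι → A) :
    D (∏ i ∈ s, f i) = ∑ i ∈ s, ∏ j ∈ s, Function.update f i (D (f i)) j := by
  induction s using Finset.induction_on with
  | empty => simp
  | insert a s ha ih =>
    have hne {i : ι} (hi : i ∈ s) : a ≠ i := fun h => ha (h ▸ hi)
    have hprod : ∏ j ∈ s, Function.update f a (D (f a)) j = ∏ j ∈ s, f j :=
      Finset.prod_congr rfl fun j hj => Function.update_of_ne (hne hj).symm _ _
    have hsum : ∑ i ∈ s, ∏ j ∈ insert a s, Function.update f i (D (f i)) j =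
        f a * D (∏ j ∈ s, f j) := by
      rw [ih, Finset.mul_sum]
      refine Finset.sum_congr rfl fun i hi => ?_
      rw [Finset.prod_insert ha, Function.update_of_ne (hne hi)]
    rw [Finset.sum_insert ha, hsum, Finset.prod_insert ha, Finset.prod_insert ha,
      Function.update_self, hprod, D.leibniz, smul_eq_mul, smul_eq_mul]
    ring

variable [Fintype ι]

theorem derivation_det (D : Derivation R A A) (M : Matrix ι ι A) :
    D M.det = ∑ i, (M.updateRow i (D ∘ M i)).det := by
  have hrow (i : ι) (σ : Equiv.Perm ι) (j : ι) : M.updateRow i (D ∘ M i) j (σ j) =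
      Function.update (fun l => M l (σ l)) i (D (M i (σ i))) j := by
    rcases eq_or_ne j i with rfl | hj <;> simp [*]
  simp only [← Matrix.det_transpose M, ← Matrix.det_transpose (M.updateRow _ _),
    Matrix.det_apply, Matrix.transpose_apply, map_sum, hrow, Units.smul_def, map_zsmul,
    derivation_prod, Finset.smul_sum]
  exact Finset.sum_comm

theorem iterate_derivation_det (D : Derivation R A A) (k : ℕ) (M : Matrix ι ι A) (i : ι)
    (h : ∀ j, j ≠ i → ∀ l, D (M j l) = 0) :
    D^[k] M.det = (M.updateRow i (D^[k] ∘ M i)).det := by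
  induction k generalizing M with
  | zero => simp
  | succ k ih =>
    have hD : D M.det = (M.updateRow i (D ∘ M i)).det := by
      rw [derivation_det]
      refine Finset.sum_eq_single i (fun j _ hj => ?_) (by simp)
      exact Matrix.det_eq_zero_of_row_eq_zero j fun l => by simp [h j hj]
    rw [Function.iterate_succ_apply, hD, ih _ fun j hj l => by simp [hj, h j hj]]
    simp [Function.iterate_succ, Function.comp_assoc]

theorem sum_det_updateRow_mul (M N : Matrix ι ι A) :
    ∑ i, (M.updateRow i ((M * N) i)).det = M.det * N.trace := by
  have hrow (i : ι) : (M.updateRow i ((M * N) i)).det = (M * N * M.adjugate) i i := by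
    rw [← Matrix.cramer_transpose_apply, Matrix.cramer_eq_adjugate_mulVec,
      ← Matrix.adjugate_transpose, Matrix.mulVec_transpose]
    rfl
  calc ∑ i, (M.updateRow i ((M * N) i)).det = (M * N * M.adjugate).trace :=
        Finset.sum_congr rfl fun i _ => hrow i
    _ = (M.adjugate * M * N).trace := by rw [Matrix.trace_mul_comm, mul_assoc]
    _ = M.det * N.trace := by
      rw [Matrix.adjugate_mul, smul_mul_assoc, one_mul, Matrix.trace_smul, smul_eq_mul]

end Determinants

section Vandermonde

theorem iterate_pderiv_X_pow {R σ : Type*} [CommSemiring R] (i : σ) (k m : ℕ) :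
    (pderiv i)^[k] (X i ^ m : MvPolynomial σ R) = m.descFactorial k • X i ^ (m - k) := by
  induction k with
  | zero => simp
  | succ k ih =>
    rw [Function.iterate_succ_apply', ih, map_nsmul, pderiv_pow, pderiv_X_self, mul_one,
      Nat.descFactorial_succ, Nat.sub_sub, mul_comm (m - k), mul_smul, nsmul_eq_mul (m - k)]

/-- The matrix of `(d/dx) ^ k` in the basis `1, x, …, x ^ (n - 1)` of the polynomials of degree less
than `n`, so that right multiplication by it differentiates the rows of a Vandermonde matrix. -/
def derivMatrix (A : Type*) [AddMonoidWithOne A] (n k : ℕ) : Matrix (Fin n) (Fin n) A :=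
  Matrix.of fun a b => if (a : ℕ) + k = b then ((b : ℕ).descFactorial k : A) else 0

theorem trace_derivMatrix (A : Type*) [NonAssocSemiring A] (n : ℕ) {k : ℕ} (hk : k ≠ 0) :
    (derivMatrix A n k).trace = 0 :=
  Finset.sum_eq_zero fun i _ => if_neg (by omega)

theorem vandermonde_mul_derivMatrix {A : Type*} [CommRing A] {n : ℕ} (x : Fin n → A) (k : ℕ)
    (i b : Fin n) :
    (Matrix.vandermonde x * derivMatrix A n k) i b =
      (b : ℕ).descFactorial k • x i ^ ((b : ℕ) - k) := by
  simp only [Matrix.mul_apply, Matrix.vandermonde_apply, derivMatrix, Matrix.of_apply, mul_ite,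
    mul_zero]
  rcases le_or_gt k b with hb | hb
  · rw [Finset.sum_eq_single ⟨b - k, by omega⟩
      (fun a _ ha => if_neg fun h => ha (Fin.ext (by simp; omega))) (by simp),
      if_pos (by simp; omega), nsmul_eq_mul, mul_comm]
  · rw [Nat.descFactorial_of_lt hb, zero_smul]
    exact Finset.sum_eq_zero fun a _ => if_neg (by omega)

variable {r n : ℕ} [NeZero r]

theorem pderiv_vandermondeX_of_ne {u : Fin r} (hu : u ≠ 0) (i : Fin n) :
    pderiv (u, i) (vandermondeX r n) = 0 := by
  rw [vandermondeX, derivation_det]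
  refine Finset.sum_eq_zero fun j _ => Matrix.det_eq_zero_of_row_eq_zero j fun l => ?_
  simp [Matrix.vandermonde_apply, hu.symm]

theorem sum_iterate_pderiv_vandermondeX {k : ℕ} (hk : k ≠ 0) :
    ∑ i, (pderiv ((0 : Fin r), i))^[k] (vandermondeX r n) = 0 := by
  let V := Matrix.vandermonde fun i : Fin n => (X (0, i) : Poly r n)
  have hrow (i : Fin n) : (pderiv ((0 : Fin r), i))^[k] (vandermondeX r n) =
      (V.updateRow i ((V * derivMatrix (Poly r n) n k) i)).det := by
    rw [vandermondeX, iterate_derivation_det _ _ _ i fun j hj l => ?_]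
    · congr 2
      ext1 b
      rw [vandermonde_mul_derivMatrix, Function.comp_apply, Matrix.vandermonde_apply,
        iterate_pderiv_X_pow]
    · rw [Matrix.vandermonde_apply, pderiv_pow, pderiv_X_of_ne (by simpa using hj), mul_zero]
  simp only [hrow, sum_det_updateRow_mul, trace_derivMatrix _ _ hk, mul_zero]

theorem sum_diffOp_monomial_vandermondeX {s : Fin r →₀ ℕ} (hs : s ≠ 0) :
    ∑ i, diffOp i (monomial s 1) (vandermondeX r n) = 0 := by
  by_cases h : ∃ u, u ≠ 0 ∧ s u ≠ 0
  · obtain ⟨u, hu, hsu⟩ := h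
    refine Finset.sum_eq_zero fun i _ => ?_
    obtain ⟨P, hP⟩ : X u ∣ monomial s (1 : ℚ) := X_dvd_monomial.mpr (.inr hsu)
    rw [hP, mul_comm, map_mul, diffOp_X, Module.End.mul_apply, Derivation.coeFn_coe,
      pderiv_vandermondeX_of_ne hu, map_zero]
  · push Not at h
    obtain ⟨k, rfl⟩ : ∃ k, s = Finsupp.single 0 k :=
      ⟨s 0, Finsupp.ext fun u => by rcases eq_or_ne u 0 with rfl | hu <;> simp [*]⟩
    simp only [← X_pow_eq_monomial, diffOp_X_pow_apply]
    exact sum_iterate_pderiv_vandermondeX (by simpa using hs)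

theorem vandermondeX_mem_harmonics : vandermondeX r n ∈ harmonics r n := by
  refine mem_harmonics.mpr fun P hP => ?_
  rw [P.as_sum]
  simp only [map_sum, LinearMap.sum_apply]
  rw [Finset.sum_comm]
  refine Finset.sum_eq_zero fun s hs => ?_
  have hs0 : s ≠ 0 := by
    rintro rfl
    exact mem_support_iff.mp hs hP
  rw [show monomial s (coeff s P) = coeff s P • monomial s 1 by simp [smul_monomial]]
  simp only [map_smul, LinearMap.smul_apply, ← Finset.smul_sum,
    sum_diffOp_monomial_vandermondeX hs0, smul_zero]

end Vandermonde

section TranslationInvariants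

variable {r n : ℕ}

/-- The polynomials in `r` sets of `n` variables that are invariant under translation of all the
variables of a set by the same amount, which is what `∑ i, ∂ f / ∂ u_i = 0` means. -/
def translationInvariants (r n : ℕ) : Submodule ℚ (Poly r n) :=
  ⨅ u, LinearMap.ker (∑ i, (pderiv (u, i)).toLinearMap)

theorem mem_translationInvariants {f : Poly r n} :
    f ∈ translationInvariants r n ↔ ∀ u, ∑ i, pderiv (u, i) f = 0 := by
  simp [translationInvariants, Submodule.mem_iInf]

theorem harmonics_le_translationInvariants : harmonics r n ≤ translationInvariants r n :=
  fun f hf => mem_translationInvariants.mpr fun u => by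
    simpa [diffOp_X] using mem_harmonics.mp hf (X u) (constantCoeff_X ℚ u)

theorem opSpan_vandermondeX_le_translationInvariants [NeZero r] :
    opSpan (vandermondeX r n) ≤ translationInvariants r n :=
  (opSpan_le vandermondeX_mem_harmonics isClosedUnderOps_harmonics).trans
    harmonics_le_translationInvariants

/-- Setting the last variable of each set to zero. -/
def setLastZero (r n : ℕ) : Poly r (n + 1) →ₐ[ℚ] Poly r n :=
  aeval fun p => Fin.lastCases (motive := fun _ => Poly r n) 0 (fun i => X (p.1, i)) p.2

/-- Replacing `u_i` by `u_i - u_{n+1}` in every set `u` of variables; a section of `setLastZero`. -/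
def subLast (r n : ℕ) : Poly r n →ₐ[ℚ] Poly r (n + 1) :=
  aeval fun p => X (p.1, p.2.castSucc) - X (p.1, Fin.last n)

/-- The shear replacing `u_i` by `u_i + c u_{n+1}`, for `i ≤ n`, in every set `u` of variables. -/
def shearLast (r n : ℕ) (c : ℚ) : Poly r (n + 1) →ₐ[ℚ] Poly r (n + 1) :=
  aeval fun p => Fin.lastCases (motive := fun _ => Poly r (n + 1)) (X (p.1, Fin.last n))
    (fun i => X (p.1, i.castSucc) + c • X (p.1, Fin.last n)) p.2

@[simp]
theorem setLastZero_X_castSucc (u : Fin r) (i : Fin n) :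
    setLastZero r n (X (u, i.castSucc)) = X (u, i) := by
  simp [setLastZero]

@[simp]
theorem setLastZero_X_last (u : Fin r) : setLastZero r n (X (u, Fin.last n)) = 0 := by
  simp [setLastZero]

@[simp]
theorem subLast_X (u : Fin r) (i : Fin n) :
    subLast r n (X (u, i)) = X (u, i.castSucc) - X (u, Fin.last n) := by
  simp [subLast]

@[simp]
theorem shearLast_X_castSucc (c : ℚ) (u : Fin r) (i : Fin n) :
    shearLast r n c (X (u, i.castSucc)) = X (u, i.castSucc) + c • X (u, Fin.last n) := by
  simp [shearLast]

@[simp]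
theorem shearLast_X_last (c : ℚ) (u : Fin r) :
    shearLast r n c (X (u, Fin.last n)) = X (u, Fin.last n) := by
  simp [shearLast]

theorem algHom_ext_last {B : Type*} [CommSemiring B] [Algebra ℚ B]
    {φ ψ : Poly r (n + 1) →ₐ[ℚ] B}
    (hcast : ∀ u (i : Fin n), φ (X (u, i.castSucc)) = ψ (X (u, i.castSucc)))
    (hlast : ∀ u, φ (X (u, Fin.last n)) = ψ (X (u, Fin.last n))) : φ = ψ :=
  algHom_ext fun ⟨u, i⟩ => i.lastCases (hlast u) (hcast u)

@[simp]
theorem setLastZero_subLast (f : Poly r n) : setLastZero r n (subLast r n f) = f := by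
  have h : (setLastZero r n).comp (subLast r n) = AlgHom.id ℚ _ := by
    ext ⟨u, i⟩ : 1
    simp
  exact DFunLike.congr_fun h f

theorem setLastZero_shearLast (c : ℚ) (f : Poly r (n + 1)) :
    setLastZero r n (shearLast r n c f) = setLastZero r n f := by
  have h : (setLastZero r n).comp (shearLast r n c) = setLastZero r n :=
    algHom_ext_last (by simp) (by simp)
  exact DFunLike.congr_fun h f

theorem shearLast_neg_shearLast (c : ℚ) (f : Poly r (n + 1)) :
    shearLast r n (-c) (shearLast r n c f) = f := by
  have h : (shearLast r n (-c)).comp (shearLast r n c) = AlgHom.id ℚ _ :=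
    algHom_ext_last (by simp) (by simp)
  exact DFunLike.congr_fun h f

theorem shearLast_neg_one_rename (f : Poly r n) :
    shearLast r n (-1) (rename (Prod.map id Fin.castSucc) f) = subLast r n f := by
  have h : (shearLast r n (-1)).comp (rename (Prod.map id Fin.castSucc)) = subLast r n := by
    ext ⟨u, i⟩ : 1
    simp [sub_eq_add_neg]
  exact DFunLike.congr_fun h f

theorem setLastZero_rename (f : Poly r n) :
    setLastZero r n (rename (Prod.map id Fin.castSucc) f) = f := by
  have h : (setLastZero r n).comp (rename (Prod.map id Fin.castSucc)) = AlgHom.id ℚ _ := by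
    ext ⟨u, i⟩ : 1
    simp
  exact DFunLike.congr_fun h f

theorem map_derivation_of_map_X {R σ B : Type*} [CommSemiring R] [CommSemiring B] [Algebra R B]
    (φ : MvPolynomial σ R →ₐ[R] B) (D : Derivation R (MvPolynomial σ R) (MvPolynomial σ R))
    (D' : Derivation R B B) (h : ∀ x, φ (D (X x)) = D' (φ (X x))) (f : MvPolynomial σ R) :
    φ (D f) = D' (φ f) := by
  induction f using MvPolynomial.induction_on with
  | C a => simp [← algebraMap_eq]
  | add p q hp hq => simp [hp, hq]
  | mul_X p x hp => simp [Derivation.leibniz, hp, h]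

theorem setLastZero_pderiv_castSucc (u : Fin r) (i : Fin n) (f : Poly r (n + 1)) :
    setLastZero r n (pderiv (u, i.castSucc) f) = pderiv (u, i) (setLastZero r n f) := by
  classical
  refine map_derivation_of_map_X _ _ _ (fun ⟨v, j⟩ => ?_) f
  induction j using Fin.lastCases with
  | last => simp [pderiv_X, (Fin.castSucc_lt_last i).ne']
  | cast j => simp [pderiv_X, Pi.single_apply, apply_ite]

theorem setLastZero_opE (u v : Fin r) (k : ℕ) (f : Poly r (n + 1)) :
    setLastZero r n (opE u v k f) = opE u v k (setLastZero r n f) := by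
  have h (i : Fin n) : setLastZero r n ((pderiv (v, i.castSucc))^[k] f) =
      (pderiv (v, i))^[k] (setLastZero r n f) :=
    (Function.Semiconj.iterate_right (setLastZero_pderiv_castSucc v i) k).eq f
  simp [opE_apply, Fin.sum_univ_castSucc, h]

theorem pderiv_last_shearLast (c : ℚ) (u : Fin r) (f : Poly r (n + 1)) :
    pderiv (u, Fin.last n) (shearLast r n c f) =
      shearLast r n c (pderiv (u, Fin.last n) f + c • ∑ i : Fin n, pderiv (u, i.castSucc) f) := by
  classical
  let D : Derivation ℚ (Poly r (n + 1)) (Poly r (n + 1)) :=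
    pderiv (u, Fin.last n) + c • ∑ i : Fin n, pderiv (u, i.castSucc)
  have hD (g : Poly r (n + 1)) :
      D g = pderiv (u, Fin.last n) g + c • ∑ i : Fin n, pderiv (u, i.castSucc) g := by
    have hsum : (∑ i : Fin n, pderiv (u, i.castSucc)) g =
        ∑ i : Fin n, pderiv (u, i.castSucc) g := by
      simp only [← Derivation.coeFnAddMonoidHom_apply, map_sum, Finset.sum_apply]
    simp only [D, Derivation.add_apply, Derivation.smul_apply, hsum]
  rw [← hD]
  refine (map_derivation_of_map_X _ _ _ (fun ⟨v, j⟩ => ?_) f).symm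
  rw [hD]
  induction j using Fin.lastCases with
  | last => simp [pderiv_X, Pi.single_apply, apply_ite, (Fin.castSucc_lt_last _).ne']
  | cast j =>
    rcases eq_or_ne v u with rfl | huv
    · simp [pderiv_X, Pi.single_apply, (Fin.castSucc_lt_last _).ne]
    · simp [pderiv_X, huv]

theorem notMem_vars_of_pderiv_eq_zero {R σ : Type*} [CommSemiring R] [NoZeroDivisors R] [CharZero R]
    {i : σ} {f : MvPolynomial σ R} (h : pderiv i f = 0) : i ∉ f.vars := by
  classical
  intro hi
  obtain ⟨m, hm, him⟩ := (mem_vars_iff_mem_support i).mp hi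
  have h1 := congrArg (coeff (m - Finsupp.single i 1)) h
  rw [coeff_pderiv, tsub_add_cancel_of_le (Finsupp.single_le_iff.mpr
    (Nat.one_le_iff_ne_zero.mpr (Finsupp.mem_support_iff.mp him))), coeff_zero] at h1
  exact (mul_eq_zero.mp h1).elim (mem_support_iff.mp hm) (Nat.cast_add_one_ne_zero _)

theorem rename_setLastZero {f : Poly r (n + 1)} (hf : ∀ u, pderiv (u, Fin.last n) f = 0) :
    rename (Prod.map id Fin.castSucc) (setLastZero r n f) = f := by
  have hvars : ↑f.vars ⊆ Set.range (Prod.map id Fin.castSucc : Fin r × Fin n → _) := by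
    rintro ⟨u, j⟩ hj
    induction j using Fin.lastCases with
    | last => exact absurd hj (notMem_vars_of_pderiv_eq_zero (hf u))
    | cast j => exact ⟨(u, j), rfl⟩
  obtain ⟨g, rfl⟩ := exists_rename_eq_of_vars_subset_range f _
    (Function.injective_id.prodMap (Fin.castSucc_injective n)) hvars
  rw [setLastZero_rename]

theorem subLast_setLastZero {f : Poly r (n + 1)} (hf : f ∈ translationInvariants r (n + 1)) :
    subLast r n (setLastZero r n f) = f := by
  have hlast (u : Fin r) : pderiv (u, Fin.last n) (shearLast r n 1 f) = 0 := by
    have hsum := mem_translationInvariants.mp hf u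
    rw [Fin.sum_univ_castSucc] at hsum
    rw [pderiv_last_shearLast, one_smul, add_comm (pderiv _ f), hsum, map_zero]
  rw [← shearLast_neg_one_rename, ← setLastZero_shearLast 1, rename_setLastZero hlast,
    shearLast_neg_shearLast]

end TranslationInvariants

section Restriction

variable {r n : ℕ}

theorem isClosedUnderOps_map_setLastZero {V : Submodule ℚ (Poly r (n + 1))}
    (hV : IsClosedUnderOps V) : IsClosedUnderOps (V.map (setLastZero r n).toLinearMap) where
  pderiv_mem := by
    rintro u i _ ⟨f, hf, rfl⟩
    exact ⟨_, hV.pderiv_mem u i.castSucc f hf, setLastZero_pderiv_castSucc u i f⟩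
  opE_mem := by
    rintro u v huv k hk _ ⟨f, hf, rfl⟩
    exact ⟨_, hV.opE_mem u v huv k hk f hf, setLastZero_opE u v k f⟩

theorem isClosedUnderOps_inf_comap_setLastZero {V : Submodule ℚ (Poly r (n + 1))}
    {W : Submodule ℚ (Poly r n)} (hV : IsClosedUnderOps V)
    (hVinv : V ≤ translationInvariants r (n + 1)) (hW : IsClosedUnderOps W) :
    IsClosedUnderOps (V ⊓ W.comap (setLastZero r n).toLinearMap) where
  pderiv_mem := by
    rintro u i f ⟨hfV, hfW⟩
    refine ⟨hV.pderiv_mem u i f hfV, ?_⟩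
    have hcast (j : Fin n) : setLastZero r n (pderiv (u, j.castSucc) f) ∈ W := by
      rw [setLastZero_pderiv_castSucc]
      exact hW.pderiv_mem u j _ hfW
    induction i using Fin.lastCases with
    | last =>
      have hsum := mem_translationInvariants.mp (hVinv hfV) u
      rw [Fin.sum_univ_castSucc] at hsum
      rw [eq_neg_of_add_eq_zero_right hsum]
      exact neg_mem (sum_mem fun j _ => hcast j)
    | cast j => exact hcast j
  opE_mem := by
    rintro u v huv k hk f ⟨hfV, hfW⟩
    refine ⟨hV.opE_mem u v huv k hk f hfV, ?_⟩
    change setLastZero r n (opE u v k f) ∈ W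
    rw [setLastZero_opE]
    exact hW.opE_mem u v huv k hk _ hfW

theorem map_setLastZero_opSpan {p : Poly r (n + 1)}
    (hp : opSpan p ≤ translationInvariants r (n + 1)) :
    (opSpan p).map (setLastZero r n).toLinearMap = opSpan (setLastZero r n p) := by
  apply le_antisymm
  · rw [Submodule.map_le_iff_le_comap]
    have hclosed := isClosedUnderOps_inf_comap_setLastZero (isClosedUnderOps_opSpan p) hp
      (isClosedUnderOps_opSpan (setLastZero r n p))
    have hmem : setLastZero r n p ∈ opSpan (setLastZero r n p) := mem_opSpan_self _
    exact (opSpan_le (Submodule.mem_inf.mpr ⟨mem_opSpan_self p, hmem⟩) hclosed).trans inf_le_right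
  · exact opSpan_le ⟨p, mem_opSpan_self p, rfl⟩
      (isClosedUnderOps_map_setLastZero (isClosedUnderOps_opSpan p))

theorem opSpan_smul {c : ℚ} (hc : c ≠ 0) (p : Poly r n) : opSpan (c • p) = opSpan p := by
  simp only [opSpan, Submodule.smul_mem_iff _ hc]

variable [NeZero r]

theorem inX_esymm : inX (esymm (Fin n) ℚ n) = ∏ i, (X (0, i) : Poly r n) := by
  have h : Finset.powersetCard n (Finset.univ : Finset (Fin n)) = {Finset.univ} := by
    simpa using Finset.powersetCard_self (Finset.univ : Finset (Fin n))
  simp [esymm, inX, h]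

theorem setLastZero_vandermondeX :
    setLastZero r n (vandermondeX r (n + 1)) =
      (-1 : ℚ) ^ n • (inX (esymm (Fin n) ℚ n) * vandermondeX r n) := by
  have hfactor (i : Fin n) :
      ∏ j ∈ Finset.Ioi i.castSucc, (setLastZero r n (X (0, j)) - X (0, i) : Poly r n) =
        -X (0, i) * ∏ j ∈ Finset.Ioi i, (X (0, j) - X (0, i)) := by
    have hIoi : Finset.Ioi i.castSucc =
        insert (Fin.last n) ((Finset.Ioi i).map Fin.castSuccEmb) := by
      rw [Fin.map_castSuccEmb_Ioi, Finset.Ioo_insert_right (Fin.castSucc_lt_last i),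
        ← Fin.top_eq_last, Finset.Ioc_top]
    rw [hIoi, Finset.prod_insert (by simp), Finset.prod_map]
    simp
  rw [inX_esymm, vandermondeX, vandermondeX, Matrix.det_vandermonde, Matrix.det_vandermonde,
    Fin.prod_univ_castSucc, ← Fin.top_eq_last, Finset.Ioi_top]
  simp only [map_mul, map_prod, map_sub, setLastZero_X_castSucc, hfactor, Finset.prod_mul_distrib,
    Finset.prod_neg]
  simp [smul_eq_C_mul, mul_assoc]

end Restriction

section Grading

theorem isWeightedHomogeneous_aeval {R σ τ M M' : Type*} [CommSemiring R] [AddCommMonoid M]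
    [AddCommMonoid M'] (φ : M →+ M') {w : σ → M} {w' : τ → M'} {g : σ → MvPolynomial τ R}
    (hg : ∀ x, IsWeightedHomogeneous w' (g x) (φ (w x))) {f : MvPolynomial σ R} {d : M}
    (hf : IsWeightedHomogeneous w f d) : IsWeightedHomogeneous w' (aeval g f) (φ d) := by
  rw [aeval_def, eval₂_eq]
  refine IsWeightedHomogeneous.sum _ _ _ fun s hs => IsWeightedHomogeneous.C_mul ?_ _
  have hφ : φ d = ∑ x ∈ s.support, s x • φ (w x) := by
    rw [← hf (mem_support_iff.mp hs), Finsupp.weight_apply, Finsupp.sum, map_sum]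
    simp only [map_nsmul]
  rw [hφ]
  exact IsWeightedHomogeneous.prod _ _ _ fun x _ => (hg x).pow _

theorem isHomogeneous_esymm (σ R : Type*) [Fintype σ] [CommSemiring R] (k : ℕ) :
    (esymm σ R k).IsHomogeneous k := by
  refine IsHomogeneous.sum _ _ _ fun s hs => ?_
  have hprod := IsHomogeneous.prod s (fun i => (X i : MvPolynomial σ R)) (fun _ => 1)
    fun i _ => isHomogeneous_X R i
  rwa [Finset.sum_const, smul_eq_mul, mul_one, (Finset.mem_powersetCard.mp hs).2] at hprod

variable {r n : ℕ}

theorem mem_homogeneousPart {d : Fin r →₀ ℕ} {f : Poly r n} :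
    f ∈ homogeneousPart r n d ↔
      IsWeightedHomogeneous (fun p : Fin r × Fin n => (Finsupp.single p.1 1 : Fin r →₀ ℕ)) f d :=
  Iff.rfl

theorem X_mem_homogeneousPart (u : Fin r) (i : Fin n) :
    (X (u, i) : Poly r n) ∈ homogeneousPart r n (Finsupp.single u 1) :=
  mem_homogeneousPart.mpr (isWeightedHomogeneous_X ℚ _ (u, i))

theorem pderiv_mem_homogeneousPart {d : Fin r →₀ ℕ} {f : Poly r n}
    (hf : f ∈ homogeneousPart r n d) (u : Fin r) (i : Fin n) :
    pderiv (u, i) f ∈ homogeneousPart r n (d - Finsupp.single u 1) := by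
  intro m hm
  rw [coeff_pderiv] at hm
  rw [← mem_homogeneousPart.mp hf (left_ne_zero_of_mul hm)]
  simp [Finsupp.weight_single]

theorem iterate_pderiv_mem_homogeneousPart {d : Fin r →₀ ℕ} {f : Poly r n}
    (hf : f ∈ homogeneousPart r n d) (u : Fin r) (i : Fin n) (k : ℕ) :
    (pderiv (u, i))^[k] f ∈ homogeneousPart r n (d - k • Finsupp.single u 1) := by
  induction k with
  | zero => simpa using hf
  | succ k ih =>
    rw [Function.iterate_succ_apply', succ_nsmul, ← tsub_tsub]
    exact pderiv_mem_homogeneousPart ih u i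

theorem opE_mem_homogeneousPart {d : Fin r →₀ ℕ} {f : Poly r n}
    (hf : f ∈ homogeneousPart r n d) (u v : Fin r) (k : ℕ) :
    opE u v k f ∈ homogeneousPart r n (Finsupp.single u 1 + (d - k • Finsupp.single v 1)) := by
  rw [opE_apply]
  exact IsWeightedHomogeneous.sum _ _ _ fun i _ =>
    (mem_homogeneousPart.mp (X_mem_homogeneousPart u i)).mul
      (iterate_pderiv_mem_homogeneousPart hf v i k)

theorem setLastZero_mem_homogeneousPart {d : Fin r →₀ ℕ} {f : Poly r (n + 1)}
    (hf : f ∈ homogeneousPart r (n + 1) d) : setLastZero r n f ∈ homogeneousPart r n d := by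
  refine isWeightedHomogeneous_aeval (AddMonoidHom.id _) (fun ⟨u, i⟩ => ?_) hf
  induction i using Fin.lastCases with
  | last => simpa using isWeightedHomogeneous_zero ℚ _ (Finsupp.single u 1)
  | cast i => simpa using mem_homogeneousPart.mp (X_mem_homogeneousPart u i)

theorem subLast_mem_homogeneousPart_iff {d : Fin r →₀ ℕ} {f : Poly r n} :
    subLast r n f ∈ homogeneousPart r (n + 1) d ↔ f ∈ homogeneousPart r n d where
  mp hf := setLastZero_subLast f ▸ setLastZero_mem_homogeneousPart hf
  mpr := isWeightedHomogeneous_aeval (AddMonoidHom.id _) fun ⟨u, i⟩ =>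
    (homogeneousPart r (n + 1) _).toSubmodule.sub_mem (X_mem_homogeneousPart u i.castSucc)
      (X_mem_homogeneousPart u (Fin.last n))

theorem map_setLastZero_inf_homogeneousPart {N : Submodule ℚ (Poly r (n + 1))}
    (hN : N ≤ translationInvariants r (n + 1)) (d : Fin r →₀ ℕ) :
    (N ⊓ (homogeneousPart r (n + 1) d).toSubmodule).map (setLastZero r n).toLinearMap =
      N.map (setLastZero r n).toLinearMap ⊓ (homogeneousPart r n d).toSubmodule := by
  ext f
  constructor
  · rintro ⟨g, ⟨hgN, hgd⟩, rfl⟩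
    exact ⟨⟨g, hgN, rfl⟩, setLastZero_mem_homogeneousPart hgd⟩
  · rintro ⟨⟨g, hgN, rfl⟩, hgd⟩
    refine ⟨g, ⟨hgN, ?_⟩, rfl⟩
    rw [← subLast_setLastZero (hN hgN)]
    exact subLast_mem_homogeneousPart_iff.mpr hgd

theorem isClosedUnderOps_iSup_inf_homogeneousPart {W : Submodule ℚ (Poly r n)}
    (hW : IsClosedUnderOps W) :
    IsClosedUnderOps (⨆ d, W ⊓ (homogeneousPart r n d).toSubmodule) where
  pderiv_mem u i := by
    suffices h : ⨆ d, W ⊓ (homogeneousPart r n d).toSubmodule ≤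
        Submodule.comap (pderiv (u, i)).toLinearMap
          (⨆ d, W ⊓ (homogeneousPart r n d).toSubmodule) from fun _ hf => h hf
    refine iSup_le fun d f hf => ?_
    exact Submodule.mem_iSup_of_mem _
      ⟨hW.pderiv_mem u i f hf.1, pderiv_mem_homogeneousPart hf.2 u i⟩
  opE_mem u v huv k hk := by
    suffices h : ⨆ d, W ⊓ (homogeneousPart r n d).toSubmodule ≤
        Submodule.comap (opE u v k) (⨆ d, W ⊓ (homogeneousPart r n d).toSubmodule) from
      fun _ hf => h hf
    refine iSup_le fun d f hf => ?_
    exact Submodule.mem_iSup_of_mem _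
      ⟨hW.opE_mem u v huv k hk f hf.1, opE_mem_homogeneousPart hf.2 u v k⟩

variable [NeZero r]

theorem inX_mem_homogeneousPart {f : MvPolynomial (Fin n) ℚ} {k : ℕ} (hf : f.IsHomogeneous k) :
    inX f ∈ homogeneousPart r n (Finsupp.single 0 k) := by
  have hX : inX f = aeval (fun i => (X (0, i) : Poly r n)) f :=
    DFunLike.congr_fun (algHom_ext fun i => by simp [inX]) f
  rw [hX]
  exact isWeightedHomogeneous_aeval (Finsupp.singleAddHom (0 : Fin r))
    (fun i => X_mem_homogeneousPart 0 i) hf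

theorem exists_vandermondeX_mem_homogeneousPart :
    ∃ d, vandermondeX r n ∈ homogeneousPart r n d := by
  rw [vandermondeX, Matrix.det_vandermonde]
  exact ⟨_, IsWeightedHomogeneous.prod _ _ _ fun i _ => IsWeightedHomogeneous.prod _ _ _ fun j _ =>
    (homogeneousPart r n _).toSubmodule.sub_mem (X_mem_homogeneousPart 0 j)
      (X_mem_homogeneousPart 0 i)⟩

theorem isGradedByDegree_Diag {f : symmetricSubalgebra (Fin n) ℚ} {k : ℕ}
    (hf : (f : MvPolynomial (Fin n) ℚ).IsHomogeneous k) : IsGradedByDegree (Diag r n f) := by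
  obtain ⟨d, hd⟩ := exists_vandermondeX_mem_homogeneousPart (r := r) (n := n)
  have hfd := (mem_homogeneousPart.mp (inX_mem_homogeneousPart (r := r) hf)).mul hd
  exact le_antisymm (iSup_le fun _ => inf_le_left)
    (opSpan_le (Submodule.mem_iSup_of_mem _ ⟨mem_opSpan_self _, hfd⟩)
      (isClosedUnderOps_iSup_inf_homogeneousPart (isClosedUnderOps_opSpan _)))

theorem toSubmodule_Diag_one : (Diag r n 1).toSubmodule = opSpan (vandermondeX r n) := by
  simp [Diag]

theorem map_setLastZero_Diag_one :
    (Diag r (n + 1) 1).toSubmodule.map (setLastZero r n).toLinearMap =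
      (Diag r n (elem n n)).toSubmodule := by
  rw [toSubmodule_Diag_one, map_setLastZero_opSpan opSpan_vandermondeX_le_translationInvariants,
    setLastZero_vandermondeX, opSpan_smul (by simp)]
  rfl

end Grading

section PowerSums

theorem powerSumEquiv_X (k : ℕ) : powerSumEquiv (X k) = psumSymm (k + 1) :=
  Subtype.ext ((AlgebraicIndependent.aevalEquiv_apply_coe algebraicIndependent_powerSum _).trans
    (aeval_X _ _))

theorem dp1_powerSumEquiv (P : MvPolynomial ℕ ℚ) :
    dp1 (powerSumEquiv P) = powerSumEquiv (pderiv 0 P) := by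
  simp [dp1]

theorem dp1_mul (a b : SymmFun) : dp1 (a * b) = dp1 a * b + a * dp1 b := by
  obtain ⟨P, rfl⟩ := powerSumEquiv.surjective a
  obtain ⟨Q, rfl⟩ := powerSumEquiv.surjective b
  simp only [← map_mul, dp1_powerSumEquiv, pderiv_mul, map_add]

theorem dp1_one : dp1 1 = 0 := by
  rw [← map_one powerSumEquiv, dp1_powerSumEquiv, pderiv_one, map_zero]

theorem dp1_psumSymm_one : dp1 (psumSymm 1) = 1 := by
  rw [← powerSumEquiv_X, dp1_powerSumEquiv, pderiv_X_self, map_one]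

theorem dp1_psumSymm_of_ne_one {k : ℕ} (hk : k ≠ 1) : dp1 (psumSymm k) = 0 := by
  cases k with
  | zero => rw [show psumSymm 0 = 1 from Subtype.ext powerSum_zero, dp1_one]
  | succ k =>
    rw [← powerSumEquiv_X, dp1_powerSumEquiv, pderiv_X_of_ne (by simpa using hk), map_zero]

theorem dp1_prod_psumSymm (s : Multiset ℕ) :
    dp1 (s.map psumSymm).prod = s.count 1 • ((s.erase 1).map psumSymm).prod := by
  induction s using Multiset.induction_on with
  | empty => simp [dp1_one]
  | cons k s ih =>
    rw [Multiset.map_cons, Multiset.prod_cons, dp1_mul, ih]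
    by_cases hk : k = 1
    · subst hk
      have hmul : s.count 1 • (psumSymm 1 * ((s.erase 1).map psumSymm).prod) =
          s.count 1 • (s.map psumSymm).prod := by
        by_cases h1 : 1 ∈ s
        · rw [Multiset.prod_map_erase h1]
        · rw [Multiset.count_eq_zero_of_notMem h1, zero_smul, zero_smul]
      rw [dp1_psumSymm_one, one_mul, mul_smul_comm, hmul, Multiset.count_cons_self,
        Multiset.erase_cons_head, succ_nsmul']
    · rw [dp1_psumSymm_of_ne_one hk, zero_mul, zero_add, Multiset.count_cons_of_ne (Ne.symm hk),
        Multiset.erase_cons_tail _ hk, Multiset.map_cons, Multiset.prod_cons,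
        mul_smul_comm]

end PowerSums

section PointStabilizer

theorem sum_card_fixed_smul_eq_card_smul_sum {G α M : Type*} [Group G] [Fintype G] [Fintype α]
    [DecidableEq α] [MulAction G α] [MulAction.IsPretransitive G α] [AddCommMonoid M] {F : G → M}
    (hF : ∀ g h, F (h * g * h⁻¹) = F g) (a : α) :
    ∑ g : G, Finset.card {b : α | g • b = b} • F g =
      Fintype.card α • ∑ g : G with g • a = a, F g := by
  have hconj (b : α) : ∑ g : G with g • b = b, F g = ∑ g : G with g • a = a, F g := by
    obtain ⟨h, rfl⟩ := MulAction.exists_smul_eq G a b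
    simp only [Finset.sum_filter]
    rw [← Equiv.sum_comp (MulAut.conj h).toEquiv]
    refine Finset.sum_congr rfl fun g _ => ?_
    simp [hF, mul_smul]
  calc ∑ g : G, Finset.card {b : α | g • b = b} • F g
      = ∑ g : G, ∑ b : α with g • b = b, F g := by simp only [Finset.sum_const]
    _ = ∑ b : α, ∑ g : G with g • b = b, F g := by
        simp only [Finset.sum_filter]
        exact Finset.sum_comm
    _ = Fintype.card α • ∑ g : G with g • a = a, F g := by
        simp only [hconj, Finset.sum_const, Finset.card_univ]

theorem count_one_parts_partition {α : Type*} [Fintype α] [DecidableEq α] (σ : Equiv.Perm α) :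
    σ.partition.parts.count 1 = Finset.card {a | σ a = a} := by
  have hcycle : σ.cycleType.count 1 = 0 :=
    Multiset.count_eq_zero_of_notMem fun h =>
      absurd (Equiv.Perm.two_le_of_mem_cycleType h) (by norm_num)
  rw [Equiv.Perm.parts_partition, Multiset.count_add, hcycle, Multiset.count_replicate_self,
    zero_add, ← Finset.card_compl]
  congr 1
  ext a
  simp

variable {n : ℕ}

@[simp]
theorem permSucc_castSucc (τ : Equiv.Perm (Fin n)) (i : Fin n) :
    permSucc n τ i.castSucc = (τ i).castSucc :=
  Equiv.Perm.viaEmbedding_apply τ Fin.castSuccEmb i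

@[simp]
theorem permSucc_last (τ : Equiv.Perm (Fin n)) : permSucc n τ (Fin.last n) = Fin.last n :=
  Equiv.Perm.viaEmbedding_apply_of_notMem τ Fin.castSuccEmb _
    (by rintro ⟨i, hi⟩; exact (Fin.castSucc_lt_last i).ne hi)

theorem cycleType_permSucc (τ : Equiv.Perm (Fin n)) :
    (permSucc n τ).cycleType = τ.cycleType := by
  classical
  have hext : permSucc n τ = τ.extendDomain (Equiv.ofInjective _ Fin.castSuccEmb.injective) := by
    simp only [permSucc, Equiv.Perm.viaEmbeddingHom_apply, Equiv.Perm.viaEmbedding]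
    congr
  rw [hext, Equiv.Perm.cycleType_extendDomain]

theorem parts_partition_permSucc (τ : Equiv.Perm (Fin n)) :
    (permSucc n τ).partition.parts = 1 ::ₘ τ.partition.parts := by
  have hle : τ.cycleType.sum ≤ n := by simpa using τ.sum_cycleType_le
  simp only [Equiv.Perm.parts_partition, ← Equiv.Perm.sum_cycleType, cycleType_permSucc,
    Fintype.card_fin]
  rw [Nat.sub_add_comm hle, Multiset.replicate_succ, Multiset.add_cons]

theorem exists_permSucc_eq {σ : Equiv.Perm (Fin (n + 1))} (hσ : σ (Fin.last n) = Fin.last n) :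
    ∃ τ, permSucc n τ = σ := by
  have hne (i : Fin n) : σ i.castSucc ≠ Fin.last n := fun hi =>
    (Fin.castSucc_lt_last i).ne (σ.injective (hi.trans hσ.symm))
  have hinj : Function.Injective fun i : Fin n => (σ i.castSucc).castPred (hne i) :=
    fun i j hij => by simpa using hij
  refine ⟨Equiv.ofBijective _ (Finite.injective_iff_bijective.mp hinj), ?_⟩
  ext1 x
  induction x using Fin.lastCases with
  | last => rw [permSucc_last, hσ]
  | cast i => simp

theorem sum_fixing_last {M : Type*} [AddCommMonoid M] (F : Equiv.Perm (Fin (n + 1)) → M) :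
    ∑ σ with σ (Fin.last n) = Fin.last n, F σ = ∑ τ, F (permSucc n τ) := by
  refine (Finset.sum_bij (fun τ _ => permSucc n τ) (by simp)
    (fun _ _ _ _ h => Equiv.Perm.viaEmbeddingHom_injective _ h) (fun σ hσ => ?_)
    fun _ _ => rfl).symm
  obtain ⟨τ, rfl⟩ := exists_permSucc_eq (Finset.mem_filter.mp hσ).2
  exact ⟨τ, Finset.mem_univ _, rfl⟩

end PointStabilizer

section Frobenius

variable {n : ℕ} {V W : Type*} [AddCommGroup V] [Module ℚ V] [AddCommGroup W] [Module ℚ W]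

theorem frobChar_congr {ρ : Representation ℚ (Equiv.Perm (Fin n)) V}
    {ρ' : Representation ℚ (Equiv.Perm (Fin n)) W} (φ : ρ.Equiv ρ') :
    frobChar ρ = frobChar ρ' := by
  rw [frobChar, frobChar, Representation.char_iso φ]

theorem dp1_frobChar (ρ : Representation ℚ (Equiv.Perm (Fin (n + 1))) V) :
    dp1 (frobChar ρ) = frobChar (ρ.comp (permSucc n)) := by
  let F (σ : Equiv.Perm (Fin (n + 1))) : SymmFun :=
    ρ.character σ • ((σ.partition.parts.erase 1).map psumSymm).prod
  have hF (σ τ : Equiv.Perm (Fin (n + 1))) : F (τ * σ * τ⁻¹) = F σ := by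
    have hpart : (τ * σ * τ⁻¹).partition = σ.partition :=
      (Equiv.Perm.partition_eq_of_isConj.mp (isConj_iff.mpr ⟨τ, rfl⟩)).symm
    simp only [F, Representation.char_conj, hpart]
  have hdp1 (σ : Equiv.Perm (Fin (n + 1))) :
      dp1 (ρ.character σ • (σ.partition.parts.map psumSymm).prod) =
        Finset.card {i : Fin (n + 1) | σ • i = i} • F σ := by
    rw [map_smul, dp1_prod_psumSymm, count_one_parts_partition, smul_comm]
    rfl
  have hres (τ : Equiv.Perm (Fin n)) : F (permSucc n τ) =
      Representation.character (V := V) (ρ.comp (permSucc n)) τ •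
        (τ.partition.parts.map psumSymm).prod := by
    simp only [F, parts_partition_permSucc, Multiset.erase_cons_head]
    rfl
  calc dp1 (frobChar ρ)
      = (1 / ((n + 1).factorial : ℚ)) • 
        ∑ σ, Finset.card {i : Fin (n + 1) | σ • i = i} • F σ := by
        simp only [frobChar, map_smul, map_sum, hdp1]
    _ = (1 / ((n + 1).factorial : ℚ)) • (n + 1) • ∑ τ, F (permSucc n τ) := by
        rw [sum_card_fixed_smul_eq_card_smul_sum hF (Fin.last n), Fintype.card_fin]
        exact congrArg _ (congrArg _ (sum_fixing_last F))
    _ = (1 / (n.factorial : ℚ)) • ∑ τ, F (permSucc n τ) := by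
        rw [← Nat.cast_smul_eq_nsmul ℚ, smul_smul, Nat.factorial_succ]
        congr 1
        push_cast
        field_simp
    _ = frobChar (ρ.comp (permSucc n)) := by
        simp only [hres, frobChar]

end Frobenius

section Isomorphism

variable {r n : ℕ}

theorem diagAction_permSucc_subLast (σ : Equiv.Perm (Fin n)) (f : Poly r n) :
    diagAction r (n + 1) (permSucc n σ) (subLast r n f) = subLast r n (diagAction r n σ f) := by
  have h : (permVars r (permSucc n σ)).comp (subLast r n) =
      (subLast r n).comp (permVars r σ) := by
    ext ⟨u, i⟩ : 1
    simp [permVars]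
  exact DFunLike.congr_fun h f

variable {M : Subrepresentation (diagAction r n)} {N : Subrepresentation (diagAction r (n + 1))}

/-- The isomorphism `f ↦ f(u_i - u_{n+1})` of `S_n`-modules from `M` to `N`, when `N` consists of
translation invariant polynomials and `M` is the restriction of `N` to `u_{n+1} = 0`. -/
def subLastEquiv (hN : N.toSubmodule ≤ translationInvariants r (n + 1))
    (hM : N.toSubmodule.map (setLastZero r n).toLinearMap = M.toSubmodule) :
    M.toRepresentation.Equiv (N.toRepresentation.comp (permSucc n)) :=
  .mk (LinearEquiv.ofLinearMap
      ((subLast r n).toLinearMap.restrict fun f (hf : f ∈ M.toSubmodule) => by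
        obtain ⟨g, hg, rfl⟩ := hM.ge hf
        exact (subLast_setLastZero (hN hg)).symm ▸ hg)
      ((setLastZero r n).toLinearMap.restrict fun f (hf : f ∈ N.toSubmodule) =>
        hM.le (Submodule.mem_map_of_mem hf))
      (LinearMap.ext fun f => Subtype.ext (subLast_setLastZero (hN f.2)))
      (LinearMap.ext fun f => Subtype.ext (setLastZero_subLast (f : Poly r n))))
    fun σ => LinearMap.ext fun f =>
      Subtype.ext (diagAction_permSucc_subLast σ (f : Poly r n)).symm

theorem subLastEquiv_mem_homogeneousPart_iff
    (hN : N.toSubmodule ≤ translationInvariants r (n + 1))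
    (hM : N.toSubmodule.map (setLastZero r n).toLinearMap = M.toSubmodule) (d : Fin r →₀ ℕ)
    (f : M.toSubmodule) :
    ((subLastEquiv hN hM f : N.toSubmodule) : Poly r (n + 1)) ∈ homogeneousPart r (n + 1) d ↔
      (f : Poly r n) ∈ homogeneousPart r n d :=
  subLast_mem_homogeneousPart_iff

theorem gradedFrob_eq_dp1Series (hN : N.toSubmodule ≤ translationInvariants r (n + 1))
    (hM : N.toSubmodule.map (setLastZero r n).toLinearMap = M.toSubmodule) :
    gradedFrob M = dp1Series (gradedFrob N) := by
  funext d
  have hNd : (N ⊓ homogeneousPart r (n + 1) d).toSubmodule ≤ translationInvariants r (n + 1) :=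
    inf_le_left.trans hN
  have hMd : (N ⊓ homogeneousPart r (n + 1) d).toSubmodule.map (setLastZero r n).toLinearMap =
      (M ⊓ homogeneousPart r n d).toSubmodule := by
    simpa only [Subrepresentation.toSubmodule_inf, hM] using
      map_setLastZero_inf_homogeneousPart hN d
  exact (frobChar_congr (subLastEquiv hNd hMd)).trans (dp1_frobChar _).symm

end Isomorphism

end DiagonalModules

end

open DiagonalModules in
theorem mainTheorem1 (r n : ℕ) [NeZero r] :
    IsGradedByDegree (Diag r n (elem n n)) ∧
    IsGradedByDegree (Diag r (n + 1) 1) ∧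
    (∃ φ : (Diag r n (elem n n)).toRepresentation.Equiv
        ((Diag r (n + 1) 1).toRepresentation.comp (permSucc n)),
      ∀ (d : Fin r →₀ ℕ) (f : (Diag r n (elem n n)).toSubmodule),
        (f : Poly r n) ∈ homogeneousPart r n d ↔
          ((φ f : (Diag r (n + 1) 1).toSubmodule) : Poly r (n + 1)) ∈
            homogeneousPart r (n + 1) d) ∧
    gradedFrob (Diag r n (elem n n)) = dp1Series (gradedFrob (Diag r (n + 1) 1)) := by
  have hinv : (Diag r (n + 1) 1).toSubmodule ≤ translationInvariants r (n + 1) :=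
    toSubmodule_Diag_one.trans_le opSpan_vandermondeX_le_translationInvariants
  exact ⟨isGradedByDegree_Diag (isHomogeneous_esymm (Fin n) ℚ n),
    isGradedByDegree_Diag (MvPolynomial.isHomogeneous_one _ ℚ),
    ⟨subLastEquiv hinv map_setLastZero_Diag_one, fun d f =>
      (subLastEquiv_mem_homogeneousPart_iff hinv map_setLastZero_Diag_one d f).symm⟩,
    gradedFrob_eq_dp1Series hinv map_setLastZero_Diag_one⟩
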